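/- Let $\mathcal{M}$ be the Gromov--Hausdorff space, i.e. the set of isometry classes of nonempty compact metric spaces endowed with the Gromov--Hausdorff distance $d_{GH}$. A graph on $\mathcal{M}$ is a finite simple graph $G=(V,E)$ with $V\subset\mathcal{M}$; its length is $|G|=\sum_{vw\in E}d_{GH}(v,w)$. It connects a finite set $M\subset\mathcal{M}$ if $G$ is connected and $M\subset V$. Put $$\operatorname{smt}(M,\mathcal{M})=\inf\{|G| : G \text{ is a graph on } \mathcal{M} \text{ connecting } M\},$$ and let $\operatorname{SMT}(M,\mathcal{M})$ be the set of all graphs $G$ on $\mathcal{M}$ connecting $M$ with $|G|=\operatorname{smt}(M,\mathcal{M})$. **Theorem.** Let $n$ be a natural number and let $M=\{m_1,\ldots,m_k\}\subset\mathcal{M}$ be a finite set, each $m_i$ being (the isometry class of) a finite metric space with at most $n$ points. Then $\operatorname{SMT}(M,\mathcal{M})\neq\emptyset$, and every graph in $\operatorname{SMT}(M,\mathcal{M})$ is a tree. In other words, $M$ can be connected by a Steiner minimal tree in $\mathcal{M}$. -/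

import Mathlib

namespace SteinerGH

/-- A (finite simple) graph on the set `X`: a finite vertex set `V ⊆ X` together with
a set of two-element subsets of `V`. -/
structure GraphOn (X : Type*) where
  verts : Finset X
  graph : SimpleGraph verts

/-- The length of an unordered pair of points: the distance between them. -/
noncomputable def edgeLength {X : Type*} [MetricSpace X] (e : Sym2 X) : ℝ :=
  Sym2.lift ⟨fun x y => dist x y, fun x y => dist_comm x y⟩ e

namespace GraphOn

open scoped Classical in
/-- The length of a graph: the sum of the lengths of all its edges. -/
noncomputable def length {X : Type*} [MetricSpace X] (G : GraphOn X) : ℝ :=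
  ∑ e ∈ G.graph.edgeFinset, edgeLength e

/-- `G` connects `M`: it is connected (in particular, it has a vertex) and every point of
`M` is a vertex of it. -/
def Connects {X : Type*} (G : GraphOn X) (M : Finset X) : Prop :=
  G.graph.Connected ∧ M ⊆ G.verts

end GraphOn

/-- The length of a Steiner minimal tree on `M`: the infimum of the lengths of the graphs on `X`
connecting `M`. -/
noncomputable def smt {X : Type*} [MetricSpace X] (M : Finset X) : ℝ :=
  sInf {l : ℝ | ∃ G : GraphOn X, G.Connects M ∧ G.length = l}

/-- The set of graphs on `X` connecting `M` whose length is `smt M`. -/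
def SMT {X : Type*} [MetricSpace X] (M : Finset X) : Set (GraphOn X) :=
  {G | G.Connects M ∧ G.length = smt M}

/-- The isometry classes of metric spaces with at most `n` points, in the Gromov-Hausdorff space
of isometry classes of nonempty compact metric spaces. -/
def atMost (n : ℕ) : Set GromovHausdorff.GHSpace :=
  {p | ENat.card p.Rep ≤ n}

end SteinerGH

/-!
A graph minimizing the length is a tree, because deleting an edge that is not a bridge keeps it
connected and shortens it (`isTree_of_mem_SMT`). The point is that a minimizer exists although the
Gromov-Hausdorff space is not proper. The problem is transferred to a proper space.

Let `T` be the finite set of all points of all the spaces in `M`. Given a graph connecting `M`,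
choose a spanning tree and an optimal correspondence on each of its edges. Starting from
`t : T`, one can choose corresponding points along the edges of the tree and obtain a point in the
space at every vertex: a thread (`Grows.exists_section`). The threads pull back the metric of every
vertex to a pseudometric on `T`. Along an edge these pseudometrics differ in the supremum norm by
at most twice the Gromov-Hausdorff distance, and at a terminal `m` the threads pass through all
points of `m`, so that the pseudometric determines `m` (`exists_lift`). Conversely, sending a
pseudometric to its metric quotient multiplies distances by at most one half (`dist_toGH_le`).
There are only finitely many possible pseudometrics at the terminals, so it suffices to find a
shortest tree with given terminals in the space of pseudometrics on `T`, a closed subset of a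
finite-dimensional space.

In a proper space shortest trees exist (`Spans.exists_isLeast`), by a recursion in the style of
Dreyfus and Wagner: a shortest tree with a given root consists of a segment to a branching point and
two shortest trees there with fewer terminals, and the branching point minimizes a continuous
coercive function. This needs no bound on the number of branching points.
-/

namespace SteinerGH

open Filter

/-! ### Rooted trees and minimal ones in proper spaces -/

/-- `Spans A p l` says that some tree in `X` with root `p` and length at most `l` passes through
every point of `A`. Trees are assembled from single points by moving the root along a segment and
by joining two trees at a common root; vertices may coincide and edges may be degenerate. -/
inductive Spans {X : Type*} [MetricSpace X] : Set X → X → ℝ → Prop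
  | single (p : X) : Spans {p} p 0
  | move {A : Set X} {p q : X} {l l' : ℝ} : Spans A p l → l + dist p q ≤ l' → Spans A q l'
  | join {A B : Set X} {p : X} {l l' : ℝ} : Spans A p l → Spans B p l' → Spans (A ∪ B) p (l + l')
  | mono {A B : Set X} {p : X} {l : ℝ} : Spans A p l → B ⊆ A → Spans B p l

namespace Spans

variable {X : Type*} [MetricSpace X] {A : Set X} {p q : X} {l : ℝ}

theorem nonneg (h : Spans A p l) : 0 ≤ l := by
  induction h with
  | single p => exact le_rfl
  | move _ hl ih => exact ih.trans ((le_add_of_nonneg_right dist_nonneg).trans hl)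
  | join _ _ ih ih' => exact add_nonneg ih ih'
  | mono _ _ ih => exact ih

theorem dist_le (h : Spans A p l) {a : X} (ha : a ∈ A) : dist a p ≤ l := by
  induction h with
  | single p => simp [Set.mem_singleton_iff.1 ha]
  | @move A p q l l' _ hl ih => linarith [ih ha, dist_triangle a p q]
  | join h h' ih ih' =>
    rcases ha with ha | ha
    · linarith [ih ha, h'.nonneg]
    · linarith [ih' ha, h.nonneg]
  | mono _ hBA ih => exact ih (hBA ha)

/-- A new leaf can be attached at any vertex, not only at the root. -/
theorem insert_leaf (h : Spans A p l) {u : X} (hu : u ∈ A) (v : X) :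
    Spans (insert v A) p (l + dist u v) := by
  induction h with
  | single p =>
    rw [Set.mem_singleton_iff.1 hu]
    exact (join (single p) (move (single v) (by rw [zero_add, dist_comm]))).mono (by
      rintro x (rfl | hx)
      · exact Or.inr rfl
      · exact Or.inl hx)
  | move _ hl ih => exact move (ih hu) (by linarith)
  | @join A B p l l' h h' ih ih' =>
    rcases hu with hu | hu
    · have := (ih hu).join h'
      rw [Set.insert_union] at this
      convert this using 1; ring
    · have := h.join (ih' hu)
      rw [Set.union_insert] at this
      convert this using 1; ring
  | mono _ hBA ih => exact (ih (hBA hu)).mono (Set.insert_subset_insert hBA)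

theorem map {Y : Type*} [MetricSpace Y] {f : X → Y} {c : ℝ} (hc : 0 ≤ c)
    (hf : ∀ x y, dist (f x) (f y) ≤ c * dist x y) (h : Spans A p l) :
    Spans (f '' A) (f p) (c * l) := by
  induction h with
  | single p => simpa using single (f p)
  | @move A p q l l' _ hl ih => exact ih.move (by nlinarith [hf p q])
  | join _ _ ih ih' =>
    rw [Set.image_union, mul_add]
    exact ih.join ih'
  | mono _ hBA ih => exact ih.mono (Set.image_mono hBA)

/-- Following a tree from its root to the first branching that separates the terminals decomposes
it into a segment and two trees with fewer terminals. -/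
theorem exists_split (h : Spans A p l) :
    ∀ A' ⊆ A, A'.Nontrivial → ∃ (q : X) (B C : Set X) (l₁ l₂ : ℝ), B.Nonempty ∧ C.Nonempty ∧
      Disjoint B C ∧ B ∪ C = A' ∧ Spans B q l₁ ∧ Spans C q l₂ ∧ l₁ + l₂ + dist q p ≤ l := by
  induction h with
  | single p =>
    intro A' hA' hn
    exact absurd (Set.subsingleton_singleton.anti hA') (Set.not_subsingleton_iff.2 hn)
  | @move A p r l l' _ hl ih =>
    intro A' hA' hn
    obtain ⟨q, B, C, l₁, l₂, hB, hC, hd, hu, h₁, h₂, hle⟩ := ih A' hA' hn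
    exact ⟨q, B, C, l₁, l₂, hB, hC, hd, hu, h₁, h₂, by linarith [dist_triangle q p r]⟩
  | @join A B p l l' h h' ih ih' =>
    intro A' hA' hn
    have hsub : A' \ A ⊆ B := fun x hx => (hA' hx.1).resolve_left hx.2
    rcases (A' ∩ A).eq_empty_or_nonempty with h0 | h1
    · have hA'B : A' ⊆ B := fun x hx => hsub ⟨hx, fun hxA => h0.subset ⟨hx, hxA⟩⟩
      obtain ⟨q, B, C, l₁, l₂, hB, hC, hd, hu, h₁, h₂, hle⟩ := ih' A' hA'B hn
      exact ⟨q, B, C, l₁, l₂, hB, hC, hd, hu, h₁, h₂, by linarith [h.nonneg]⟩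
    rcases (A' \ A).eq_empty_or_nonempty with h0 | h2
    · obtain ⟨q, B, C, l₁, l₂, hB, hC, hd, hu, h₁, h₂, hle⟩ :=
        ih A' (Set.sdiff_eq_empty.1 h0) hn
      exact ⟨q, B, C, l₁, l₂, hB, hC, hd, hu, h₁, h₂, by linarith [h'.nonneg]⟩
    exact ⟨p, A' ∩ A, A' \ A, l, l', h1, h2, Set.disjoint_sdiff_inter.symm,
      Set.inter_union_sdiff A' A, h.mono Set.inter_subset_right, h'.mono hsub, by simp⟩
  | mono _ hBA ih => exact fun A' hA' hn => ih A' (hA'.trans hBA) hn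

/-- The shortest length of a tree, as a function of its root, is continuous. -/
theorem continuous_of_isLeast {F : X → ℝ} (hF : ∀ p, IsLeast {l | Spans A p l} (F p)) :
    Continuous F :=
  (LipschitzWith.of_le_add fun x y =>
    (hF x).2 ((hF y).1.move (by rw [dist_comm]))).continuous

/-- In a proper space, shortest trees with given root and terminals exist. By induction on the
number of terminals, only the first branching point has to be found, and it minimizes a continuous
coercive function. -/
theorem exists_isLeast [ProperSpace X] (hA : A.Finite) (hne : A.Nonempty) (p : X) :
    ∃ l, IsLeast {l | Spans A p l} l := by
  induction hk : A.ncard using Nat.strong_induction_on generalizing A p with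
  | _ k ih =>
  rcases hne.exists_eq_singleton_or_nontrivial with ⟨a, rfl⟩ | hnt
  · exact ⟨dist a p, (single a).move (by simp), fun l hl => hl.dist_le rfl⟩
  have key : ∀ B : Set X, B ⊂ A ∧ B.Nonempty →
      ∃ l : ℝ, Spans A p l ∧ ∀ (q' : X) (l₁ l₂ : ℝ), Spans B q' l₁ → Spans (A \ B) q' l₂ →
        l ≤ l₁ + l₂ + dist q' p := by
    rintro B ⟨hBA, hB⟩
    have hC : (A \ B).Nonempty := Set.nonempty_of_ssubset hBA
    choose F hF using fun q => ih B.ncard (hk ▸ Set.ncard_lt_ncard hBA hA)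
      (hA.subset hBA.1) hB q rfl
    have hCA : A \ B ⊂ A := by
      refine ⟨Set.sdiff_subset, fun h => ?_⟩
      obtain ⟨b, hb⟩ := hB
      exact (h (hBA.1 hb)).2 hb
    choose G hG using fun q => ih (A \ B).ncard (hk ▸ Set.ncard_lt_ncard hCA hA)
      (hA.subset hCA.1) hC q rfl
    have hcont : Continuous fun q => F q + G q + dist q p :=
      ((continuous_of_isLeast hF).add (continuous_of_isLeast hG)).add
        (continuous_id.dist continuous_const)
    have hlim : Tendsto (fun q => F q + G q + dist q p) (cocompact X) atTop :=
      tendsto_atTop_mono (fun q => le_add_of_nonneg_left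
        (add_nonneg (hF q).1.nonneg (hG q).1.nonneg)) (tendsto_dist_right_cocompact_atTop p)
    have : Nonempty X := ⟨p⟩
    obtain ⟨q, hq⟩ := hcont.exists_forall_le hlim
    refine ⟨_, ?_, fun q' l₁ l₂ h₁ h₂ => (hq q').trans ?_⟩
    · have := ((hF q).1.join (hG q).1).move (q := p) le_rfl
      rwa [Set.union_sdiff_cancel hBA.1] at this
    · linarith [(hF q').2 h₁, (hG q').2 h₂]
  choose! l hl hmin using key
  have hfin : {B : Set X | B ⊂ A ∧ B.Nonempty}.Finite :=
    hA.finite_subsets.subset fun B hB => hB.1.1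
  have hnemp : {B : Set X | B ⊂ A ∧ B.Nonempty}.Nonempty := by
    obtain ⟨a, ha, b, hb, hab⟩ := hnt
    exact ⟨{a}, ⟨Set.singleton_subset_iff.2 ha, fun h => hab (h hb).symm⟩, a, rfl⟩
  obtain ⟨B₀, hB₀, hmin₀⟩ := Set.exists_min_image _ l hfin hnemp
  refine ⟨l B₀, hl B₀ hB₀, fun m hm => ?_⟩
  obtain ⟨q', B, C, l₁, l₂, hB, hC, hd, rfl, h₁, h₂, hle⟩ := exists_split hm A subset_rfl hnt
  have hBmem : B ⊂ B ∪ C ∧ B.Nonempty := by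
    refine ⟨⟨Set.subset_union_left, fun h => ?_⟩, hB⟩
    obtain ⟨c, hc⟩ := hC
    exact hd.le_bot ⟨h (Or.inr hc), hc⟩
  have hCeq : (B ∪ C) \ B = C := by
    rw [Set.union_sdiff_left, hd.sdiff_eq_right]
  exact (hmin₀ B hBmem).trans ((hmin B hBmem q' l₁ l₂ h₁ (hCeq.symm ▸ h₂)).trans hle)

end Spans

/-! ### Graphs and rooted trees -/

theorem edgeLength_mk {X : Type*} [MetricSpace X] (x y : X) : edgeLength s(x, y) = dist x y := rfl

theorem edgeLength_nonneg {X : Type*} [MetricSpace X] (e : Sym2 X) : 0 ≤ edgeLength e := by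
  induction e with
  | h x y => exact dist_nonneg

theorem GraphOn.length_nonneg {X : Type*} [MetricSpace X] (G : GraphOn X) : 0 ≤ G.length :=
  Finset.sum_nonneg fun e _ => edgeLength_nonneg e

theorem smt_le {X : Type*} [MetricSpace X] {M : Finset X} {G : GraphOn X} (hG : G.Connects M) :
    smt M ≤ G.length :=
  csInf_le ⟨0, by rintro _ ⟨G, -, rfl⟩; exact G.length_nonneg⟩ ⟨G, hG, rfl⟩

/-- Otherwise an edge that is not a bridge could be deleted, and edges have positive length. -/
theorem isTree_of_mem_SMT {X : Type*} [MetricSpace X] {M : Finset X} {G : GraphOn X}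
    (hG : G ∈ SMT M) : G.graph.IsTree := by
  classical
  obtain ⟨⟨hconn, hM⟩, hlen⟩ := hG
  refine ⟨hconn, SimpleGraph.isAcyclic_iff_forall_isBridge.2 ?_⟩
  by_contra! h
  obtain ⟨e, he, hb⟩ := h
  induction e with
  | h x y =>
  have hconn' := hconn.connected_delete_edge_of_not_isBridge hb
  have hle := smt_le (M := M) (G := ⟨G.verts, G.graph.deleteEdges {s(x, y)}⟩) ⟨hconn', hM⟩
  have hadj : G.graph.Adj x y := he
  have hxy : (0 : ℝ) < edgeLength s(x, y) := by
    rw [edgeLength_mk]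
    exact dist_pos.2 hadj.ne
  rw [← hlen] at hle
  refine hle.not_gt ?_
  unfold GraphOn.length
  refine Finset.sum_lt_sum_of_subset (i := s(x, y)) ?_ ?_ ?_ hxy fun e _ _ => edgeLength_nonneg e
  · intro e
    simp only [SimpleGraph.mem_edgeFinset, SimpleGraph.edgeSet_deleteEdges]
    exact fun h => h.1
  · exact SimpleGraph.mem_edgeFinset.2 he
  · simp

theorem sum_edgeLength_union_le {X : Type*} [MetricSpace X] [DecidableEq X]
    (E E' : Finset (Sym2 X)) :
    ∑ e ∈ E ∪ E', edgeLength e ≤ ∑ e ∈ E, edgeLength e + ∑ e ∈ E', edgeLength e := by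
  rw [← Finset.sum_union_inter]
  exact le_add_of_nonneg_right (Finset.sum_nonneg fun e _ => edgeLength_nonneg e)

/-- Overlapping edges and vertices of a rooted tree merge, which only shortens the graph. -/
theorem Spans.exists_subgraph {X : Type*} [MetricSpace X] {A : Set X} {p : X} {l : ℝ}
    (h : Spans A p l) :
    ∃ S : (⊤ : SimpleGraph X).Subgraph, S.Connected ∧ S.verts.Finite ∧ A ⊆ S.verts ∧ p ∈ S.verts ∧
      ∃ E : Finset (Sym2 X), S.edgeSet ⊆ E ∧ ∑ e ∈ E, edgeLength e ≤ l := by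
  classical
  induction h with
  | single p =>
    exact ⟨_, SimpleGraph.Subgraph.singletonSubgraph_connected, Set.finite_singleton p,
      subset_rfl, rfl, ∅, by simp, by simp⟩
  | @move A p q l l' _ hl ih =>
    obtain ⟨S, hS, hfin, hA, hp, E, hE, hlen⟩ := ih
    by_cases hpq : p = q
    · subst hpq
      exact ⟨S, hS, hfin, hA, hp, E, hE, hlen.trans (by simpa using hl)⟩
    have hadj : (⊤ : SimpleGraph X).Adj p q := hpq
    refine ⟨S ⊔ SimpleGraph.subgraphOfAdj _ hadj, ?_, ?_, ?_, ?_, E ∪ {s(p, q)}, ?_, ?_⟩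
    · exact SimpleGraph.Subgraph.connected_sup hS.preconnected
        (SimpleGraph.Subgraph.subgraphOfAdj_connected hadj).preconnected ⟨p, hp, by simp⟩
    · exact hfin.union (by simp)
    · exact hA.trans Set.subset_union_left
    · exact Or.inr (by simp)
    · rw [SimpleGraph.Subgraph.edgeSet_sup, SimpleGraph.edgeSet_subgraphOfAdj, Finset.coe_union,
        Finset.coe_singleton]
      exact Set.union_subset_union_left _ hE
    · refine (sum_edgeLength_union_le _ _).trans ?_
      rw [Finset.sum_singleton, edgeLength_mk]; linarith
  | join _ _ ih ih' =>
    obtain ⟨S, hS, hfin, hA, hp, E, hE, hlen⟩ := ih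
    obtain ⟨S', hS', hfin', hA', hp', E', hE', hlen'⟩ := ih'
    refine ⟨S ⊔ S', ?_, hfin.union hfin', Set.union_subset_union hA hA', Or.inl hp, E ∪ E', ?_, ?_⟩
    · exact SimpleGraph.Subgraph.connected_sup hS.preconnected hS'.preconnected ⟨_, hp, hp'⟩
    · rw [SimpleGraph.Subgraph.edgeSet_sup, Finset.coe_union]
      exact Set.union_subset_union hE hE'
    · exact (sum_edgeLength_union_le _ _).trans (add_le_add hlen hlen')
  | mono _ hBA ih =>
    obtain ⟨S, hS, hfin, hA, hp, E, hE, hlen⟩ := ih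
    exact ⟨S, hS, hfin, hBA.trans hA, hp, E, hE, hlen⟩

theorem Spans.exists_connects {X : Type*} [MetricSpace X] {M : Finset X} {p : X} {l : ℝ}
    (h : Spans (M : Set X) p l) : ∃ G : GraphOn X, G.Connects M ∧ G.length ≤ l := by
  classical
  obtain ⟨S, hS, hfin, hA, hp, E, hE, hlen⟩ := h.exists_subgraph
  let f : hfin.toFinset ≃ S.verts := Equiv.subtypeEquivRight fun x => hfin.mem_toFinset
  refine ⟨⟨hfin.toFinset, S.coe.comap f⟩, ⟨?_, ?_⟩, le_trans ?_ hlen⟩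
  · exact (SimpleGraph.Iso.connected_iff (SimpleGraph.Iso.comap f S.coe)).2 hS.coe
  · intro x hx
    exact hfin.mem_toFinset.2 (hA hx)
  · have hinj : Function.Injective (Sym2.map (Subtype.val : hfin.toFinset → X)) :=
      Sym2.map.injective Subtype.val_injective
    have hval : ∀ e : Sym2 hfin.toFinset, edgeLength (e.map Subtype.val) = edgeLength e := by
      intro e
      induction e with
      | h x y => rfl
    unfold GraphOn.length
    simp_rw [← hval]
    rw [← Finset.sum_image (f := edgeLength) hinj.injOn]
    refine Finset.sum_le_sum_of_subset_of_nonneg ?_ fun e _ _ => edgeLength_nonneg e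
    intro e he
    obtain ⟨e, he', rfl⟩ := Finset.mem_image.1 he
    clear he
    induction e with
    | h x y =>
      rw [SimpleGraph.mem_edgeFinset, SimpleGraph.mem_edgeSet] at he'
      have hadj : S.Adj x y := he'
      exact hE hadj

/-! ### Spanning trees grown from a root -/

/-- `Grows p V E` says that the tree with vertex set `V` and list `E` of edges, each written as
(parent, child), arises from the single vertex `p` by attaching leaves. -/
inductive Grows {ι : Type*} (p : ι) : Set ι → List (ι × ι) → Prop
  | single : Grows p {p} []
  | leaf {V : Set ι} {E : List (ι × ι)} {u v : ι} :
      Grows p V E → u ∈ V → v ∉ V → Grows p (insert v V) ((u, v) :: E)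

namespace Grows

variable {ι : Type*} {p : ι} {V : Set ι} {E : List (ι × ι)}

theorem root_mem (h : Grows p V E) : p ∈ V := by
  induction h with
  | single => rfl
  | leaf _ _ _ ih => exact Or.inr ih

theorem mem_of_mem (h : Grows p V E) {e : ι × ι} (he : e ∈ E) : e.1 ∈ V ∧ e.2 ∈ V := by
  induction h with
  | single => simp at he
  | leaf _ hu hv ih =>
    rcases List.mem_cons.1 he with rfl | he
    · exact ⟨Or.inr hu, Or.inl rfl⟩
    · exact ⟨Or.inr (ih he).1, Or.inr (ih he).2⟩

theorem nodup (h : Grows p V E) : (E.map fun e => s(e.1, e.2)).Nodup := by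
  induction h with
  | single => simp
  | @leaf V E u v h hu hv ih =>
    rw [List.map_cons, List.nodup_cons]
    refine ⟨fun hmem => ?_, ih⟩
    obtain ⟨e, he, heq⟩ := List.mem_map.1 hmem
    rcases Sym2.eq_iff.1 heq with ⟨-, h2⟩ | ⟨h1, -⟩
    · exact hv ((show e.2 = v from h2) ▸ (h.mem_of_mem he).2)
    · exact hv ((show e.1 = v from h1) ▸ (h.mem_of_mem he).1)

theorem exists_of_connected [Finite ι] {H : SimpleGraph ι} (hH : H.Connected) (p : ι) :
    ∃ E, Grows p Set.univ E ∧ ∀ e ∈ E, H.Adj e.1 e.2 := by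
  obtain ⟨V, hV⟩ := (Set.toFinite {V | ∃ E, Grows p V E ∧ ∀ e ∈ E, H.Adj e.1 e.2}).exists_maximal
    ⟨{p}, [], single, by simp⟩
  obtain ⟨E, hE, hadj⟩ := hV.prop
  suffices V = Set.univ from ⟨E, this ▸ hE, hadj⟩
  by_contra hne
  obtain ⟨w, hw⟩ := (Set.ne_univ_iff_exists_notMem V).1 hne
  obtain ⟨d, -, hd, hd'⟩ := (hH.preconnected p w).some.exists_boundary_dart V hE.root_mem hw
  refine hd' (hV.le_of_ge ⟨_, hE.leaf hd hd', ?_⟩ (Set.subset_insert _ _) (Set.mem_insert _ _))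
  intro e he
  rcases List.mem_cons.1 he with rfl | he
  · exact d.adj
  · exact hadj e he

/-- Since a tree has no cycles, a choice of a value at one vertex propagates along the edges to
the whole tree, in both directions of every edge. -/
theorem exists_section (h : Grows p V E) {F : ι → Type*} [∀ v, Nonempty (F v)]
    (R : ∀ u v, F u → F v → Prop) (hR : ∀ e ∈ E, (∀ x, ∃ y, R e.1 e.2 x y) ∧
      ∀ y, ∃ x, R e.1 e.2 x y) {m : ι} (hm : m ∈ V) (y : F m) :
    ∃ x : ∀ v, F v, x m = y ∧ ∀ e ∈ E, R e.1 e.2 (x e.1) (x e.2) := by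
  classical
  induction h generalizing m with
  | single =>
    exact ⟨Function.update (fun v => Classical.arbitrary _) m y, by simp, by simp⟩
  | @leaf V E u v h hu hv ih =>
    have hext : ∀ (x : ∀ v, F v) (z : F v), (∀ e ∈ E, R e.1 e.2 (x e.1) (x e.2)) →
        R u v (x u) z → ∀ e ∈ (u, v) :: E, R e.1 e.2 (Function.update x v z e.1)
          (Function.update x v z e.2) := by
      intro x z hx hz e he
      rcases List.mem_cons.1 he with rfl | he
      · have huv : u ≠ v := fun h => hv (h ▸ hu)
        simpa [Function.update_of_ne huv] using hz
      · have h1 : e.1 ≠ v := fun h1 => hv (h1 ▸ (h.mem_of_mem he).1)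
        have h2 : e.2 ≠ v := fun h2 => hv (h2 ▸ (h.mem_of_mem he).2)
        rw [Function.update_of_ne h1, Function.update_of_ne h2]
        exact hx e he
    have ih := fun {m} => ih (fun e he => hR e (List.mem_cons_of_mem _ he)) (m := m)
    obtain ⟨hR₁, hR₂⟩ := hR (u, v) List.mem_cons_self
    by_cases hmv : m = v
    · subst hmv
      obtain ⟨y', hy'⟩ := hR₂ y
      obtain ⟨x, hxu, hx⟩ := ih hu y'
      exact ⟨_, Function.update_self m y x, hext x y hx (hxu ▸ hy')⟩
    · obtain ⟨x, hxm, hx⟩ := ih (hm.resolve_left hmv) y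
      obtain ⟨z, hz⟩ := hR₁ (x u)
      exact ⟨_, (Function.update_of_ne hmv _ _).trans hxm, hext x z hx hz⟩

theorem spans (h : Grows p V E) {X : Type*} [MetricSpace X] (φ : ι → X) :
    Spans (φ '' V) (φ p) (E.map fun e => dist (φ e.1) (φ e.2)).sum := by
  induction h with
  | single => simpa using Spans.single (φ p)
  | @leaf V E u v h hu hv ih =>
    rw [Set.image_insert_eq, List.map_cons, List.sum_cons, add_comm]
    exact ih.insert_leaf (Set.mem_image_of_mem φ hu) (φ v)

theorem sum_dist_le {X : Type*} [MetricSpace X] {G : GraphOn X} {p : G.verts} {V : Set G.verts}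
    {E : List (G.verts × G.verts)} (h : Grows p V E) (hE : ∀ e ∈ E, G.graph.Adj e.1 e.2) :
    (E.map fun e => dist e.1 e.2).sum ≤ G.length := by
  classical
  have : (E.map fun e => dist e.1 e.2) = (E.map fun e => s(e.1, e.2)).map edgeLength := by
    rw [List.map_map]; rfl
  rw [this, ← List.sum_toFinset _ h.nodup]
  refine Finset.sum_le_sum_of_subset_of_nonneg ?_ fun e _ _ => edgeLength_nonneg e
  intro e he
  obtain ⟨e, he', rfl⟩ := List.mem_map.1 (List.mem_toFinset.1 he)
  exact SimpleGraph.mem_edgeFinset.2 (hE e he')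

end Grows

/-! ### Correspondences and the Gromov-Hausdorff distance -/

open GromovHausdorff Metric in
/-- Two compact spaces parametrized by the same set, with distances differing by at most `2 * ε`,
are at Gromov-Hausdorff distance at most `ε`. -/
theorem dist_toGHSpace_le {X Y Z : Type*} [MetricSpace X] [CompactSpace X] [Nonempty X]
    [MetricSpace Y] [CompactSpace Y] [Nonempty Y] [Nonempty Z] {f : Z → X} {g : Z → Y}
    (hf : f.Surjective) (hg : g.Surjective) {ε : ℝ} (hε : 0 ≤ ε)
    (H : ∀ s t, |dist (f s) (f t) - dist (g s) (g t)| ≤ 2 * ε) :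
    dist (toGHSpace X) (toGHSpace Y) ≤ ε := by
  refine le_of_forall_pos_le_add fun δ δ0 => ?_
  have H' : ∀ s t, |dist (f s) (f t) - dist (g s) (g t)| ≤ 2 * (ε + δ) := fun s t =>
    (H s t).trans (by linarith)
  -- Gluing `f z` to `g z` at distance zero would only give a pseudometric, hence the `δ`.
  let _ : MetricSpace (X ⊕ Y) := glueMetricApprox f g (ε + δ) (by linarith) H'
  have Il : Isometry (Sum.inl : X → X ⊕ Y) := Isometry.of_dist_eq fun x y => rfl
  have Ir : Isometry (Sum.inr : Y → X ⊕ Y) := Isometry.of_dist_eq fun x y => rfl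
  refine (ghDist_le_hausdorffDist Il Ir).trans
    (hausdorffDist_le_of_mem_dist (by linarith) ?_ ?_)
  · rintro _ ⟨x, rfl⟩
    obtain ⟨z, rfl⟩ := hf x
    exact ⟨_, ⟨g z, rfl⟩, (glueDist_glued_points f g (ε + δ) z).le⟩
  · rintro _ ⟨y, rfl⟩
    obtain ⟨z, rfl⟩ := hg y
    refine ⟨_, ⟨f z, rfl⟩, ?_⟩
    rw [dist_comm]
    exact (glueDist_glued_points f g (ε + δ) z).le

open GromovHausdorff Metric in
/-- Being at most `dist p q` apart in an optimal coupling is a correspondence between `p` and `q`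
whose distortion is at most twice their Gromov-Hausdorff distance. -/
theorem exists_correspondence (p q : GHSpace) :
    ∃ R : p.Rep → q.Rep → Prop, (∀ x, ∃ y, R x y) ∧ (∀ y, ∃ x, R x y) ∧
      ∀ x x' y y', R x y → R x' y' → |dist x x' - dist y y'| ≤ 2 * dist p q := by
  set f := optimalGHInjl p.Rep q.Rep
  set g := optimalGHInjr p.Rep q.Rep
  have If : Isometry f := isometry_optimalGHInjl _ _
  have Ig : Isometry g := isometry_optimalGHInjr _ _
  have hd : hausdorffDist (Set.range f) (Set.range g) = dist p q := by
    rw [dist_ghDist]; exact hausdorffDist_optimal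
  have hfc := isCompact_range If.continuous
  have hgc := isCompact_range Ig.continuous
  have hfin : hausdorffEDist (Set.range f) (Set.range g) ≠ ⊤ :=
    hausdorffEDist_ne_top_of_nonempty_of_bounded (Set.range_nonempty _) (Set.range_nonempty _)
      hfc.isBounded hgc.isBounded
  refine ⟨fun x y => dist (f x) (g y) ≤ dist p q, fun x => ?_, fun y => ?_, ?_⟩
  · obtain ⟨_, ⟨y, rfl⟩, hy⟩ := hgc.exists_infDist_eq_dist (Set.range_nonempty _) (f x)
    refine ⟨y, ?_⟩
    change dist (f x) (g y) ≤ dist p q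
    rw [← hy, ← hd]
    exact infDist_le_hausdorffDist_of_mem ⟨x, rfl⟩ hfin
  · obtain ⟨_, ⟨x, rfl⟩, hx⟩ := hfc.exists_infDist_eq_dist (Set.range_nonempty _) (g y)
    refine ⟨x, ?_⟩
    change dist (f x) (g y) ≤ dist p q
    rw [dist_comm, ← hx, ← hd, hausdorffDist_comm]
    exact infDist_le_hausdorffDist_of_mem ⟨y, rfl⟩ (by rwa [hausdorffEDist_comm])
  · intro x x' y y' h h'
    have h1 := dist_dist_dist_le (f x) (f x') (g y) (g y')
    rw [If.dist_eq, Ig.dist_eq, Real.dist_eq] at h1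
    linarith

/-! ### The space of pseudometrics on a finite set -/

/-- The pseudometrics on `T`, as functions of two variables. -/
def pseudometrics (T : Type*) : Set (T → T → ℝ) :=
  {d | (∀ t, d t t = 0) ∧ (∀ s t, d s t = d t s) ∧ ∀ r s t, d r t ≤ d r s + d s t}

theorem isClosed_pseudometrics (T : Type*) : IsClosed (pseudometrics T) := by
  have h (s t : T) : Continuous fun d : T → T → ℝ => d s t :=
    (continuous_apply t).comp (continuous_apply s)
  simp only [pseudometrics, Set.ofPred_and, Set.ofPred_forall]
  exact (isClosed_iInter fun t => isClosed_eq (h t t) continuous_const).inter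
    ((isClosed_iInter fun s => isClosed_iInter fun t => isClosed_eq (h s t) (h t s)).inter
      (isClosed_iInter fun r => isClosed_iInter fun s => isClosed_iInter fun t =>
        isClosed_le (h r t) ((h r s).add (h s t))))

-- `T → T → ℝ` carries the supremum norm, which measures the distortion of the identity of `T`.
instance {T : Type*} [Fintype T] : ProperSpace (pseudometrics T) :=
  LipschitzWith.properSpace (isClosed_pseudometrics T).isClosedEmbedding_subtypeVal.isProperMap
    (LipschitzWith.subtype_val _)

/-- The pseudometric on `T` induced by a map into a metric space. -/
def pullback {T X : Type*} [MetricSpace X] (f : T → X) : pseudometrics T :=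
  ⟨fun s t => dist (f s) (f t), fun _ => dist_self _, fun _ _ => dist_comm _ _,
    fun _ _ _ => dist_triangle _ _ _⟩

theorem dist_pullback_le {T X Y : Type*} [Fintype T] [MetricSpace X] [MetricSpace Y] {f : T → X}
    {g : T → Y} {c : ℝ} (hc : 0 ≤ c) (h : ∀ s t, |dist (f s) (f t) - dist (g s) (g t)| ≤ c) :
    dist (pullback f) (pullback g) ≤ c := by
  rw [Subtype.dist_eq, dist_pi_le_iff hc]
  refine fun s => (dist_pi_le_iff hc).2 fun t => ?_
  exact h s t

/-- A copy of `T` carrying the pseudometric `d`. -/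
def Carrier {T : Type*} (_d : pseudometrics T) : Type _ := T

noncomputable instance {T : Type*} (d : pseudometrics T) : PseudoMetricSpace (Carrier d) where
  dist s t := d.1 s t
  dist_self := d.2.1
  dist_comm := d.2.2.1
  dist_triangle := d.2.2.2

instance {T : Type*} [Finite T] (d : pseudometrics T) : Finite (Carrier d) := ‹Finite T›

instance {T : Type*} [Nonempty T] (d : pseudometrics T) : Nonempty (Carrier d) := ‹Nonempty T›

/-- The quotient map from `T` to the metric space defined by a pseudometric on `T`. -/
noncomputable def toQuotient {T : Type*} (d : pseudometrics T) (t : T) :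
    SeparationQuotient (Carrier d) :=
  SeparationQuotient.mk (show Carrier d from t)

theorem toQuotient_surjective {T : Type*} (d : pseudometrics T) :
    Function.Surjective (toQuotient d) :=
  SeparationQuotient.surjective_mk (X := Carrier d)

instance {T : Type*} [Finite T] (d : pseudometrics T) : Finite (SeparationQuotient (Carrier d)) :=
  .of_surjective _ (toQuotient_surjective d)

theorem dist_toQuotient {T : Type*} (d : pseudometrics T) (s t : T) :
    dist (toQuotient d s) (toQuotient d t) = d.1 s t := rfl

/-- The isometry class of the metric space obtained by identifying points at distance zero. -/
noncomputable def toGH {T : Type*} [Finite T] [Nonempty T] (d : pseudometrics T) :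
    GromovHausdorff.GHSpace :=
  GromovHausdorff.toGHSpace (SeparationQuotient (Carrier d))

theorem dist_toGH_le {T : Type*} [Fintype T] [Nonempty T] (d d' : pseudometrics T) :
    dist (toGH d) (toGH d') ≤ 1 / 2 * dist d d' := by
  refine dist_toGHSpace_le (toQuotient_surjective d) (toQuotient_surjective d')
    (by positivity) fun s t => ?_
  rw [dist_toQuotient, dist_toQuotient, Subtype.dist_eq, ← Real.dist_eq]
  linarith [dist_le_pi_dist d.1 d'.1 s, dist_le_pi_dist (d.1 s) (d'.1 s) t]

theorem toGH_pullback {T : Type*} [Finite T] [Nonempty T] {p : GromovHausdorff.GHSpace}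
    {f : T → p.Rep} (hf : f.Surjective) : toGH (pullback f) = p := by
  refine dist_le_zero.1 ?_
  refine (congrArg (dist _) p.toGHSpace_rep.symm).trans_le ?_
  refine dist_toGHSpace_le (toQuotient_surjective _) hf le_rfl fun s t => ?_
  rw [dist_toQuotient]
  simp [pullback]

/-! ### Lifting a graph to the space of pseudometrics -/

open GromovHausdorff

theorem finite_rep_of_mem_atMost {n : ℕ} {m : GHSpace} (hm : m ∈ atMost n) : Finite m.Rep :=
  ENat.card_lt_top.1 (lt_of_le_of_lt hm (ENat.natCast_lt_top n))

/-- The points of the spaces in `M`; each of them is the origin of a thread through a tree. -/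
abbrev Threads (M : Finset GHSpace) : Type := Σ m : M, m.1.Rep

/-- The families of pseudometrics on the set of threads that can arise at the terminals: at `m`,
the pullback of the metric of `m` along some surjection. -/
def terminalLifts (M : Finset GHSpace) : Set (M → pseudometrics (Threads M)) :=
  {φ | ∀ m, ∃ f : Threads M → m.1.Rep, f.Surjective ∧ φ m = pullback f}

theorem finite_terminalLifts {M : Finset GHSpace} [∀ m : M, Finite m.1.Rep] :
    (terminalLifts M).Finite := by
  refine (Set.Finite.pi' fun m : M => Set.finite_range fun f : Threads M → m.1.Rep =>
    pullback f).subset fun φ hφ m => ?_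
  obtain ⟨f, -, h⟩ := hφ m
  exact ⟨f, h.symm⟩

/-- Each thread is continued from its origin by choosing corresponding points edge by edge, so the
threads give the space at each vertex a pseudometric on one common finite set. Along a
spanning tree of a connecting graph, distances grow by a factor of at most two. -/
theorem exists_lift {M : Finset GHSpace} [Fintype (Threads M)] (m₀ : M) {G : GraphOn GHSpace}
    (hG : G.Connects M) :
    ∃ φ ∈ terminalLifts M, Spans (Set.range φ) (φ m₀) (2 * G.length) := by
  have : Finite G.verts := inferInstance
  obtain ⟨E, hE, hadj⟩ := Grows.exists_of_connected hG.1 ⟨m₀.1, hG.2 m₀.2⟩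
  choose R hR₁ hR₂ hR using fun u v : G.verts => exists_correspondence u.1 v.1
  -- `x t v` is the point at which the thread `t` passes through the space `v`.
  choose x hx hxE using fun t : Threads M => hE.exists_section (F := fun v => v.1.Rep) R
    (fun e _ => ⟨hR₁ e.1 e.2, hR₂ e.1 e.2⟩) (Set.mem_univ ⟨t.1.1, hG.2 t.1.2⟩) t.2
  let φ : G.verts → pseudometrics (Threads M) := fun v => pullback fun t => x t v
  refine ⟨fun m => φ ⟨m.1, hG.2 m.2⟩, fun m => ⟨fun t => x t ⟨m.1, hG.2 m.2⟩, ?_, rfl⟩, ?_⟩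
  · exact fun y => ⟨⟨m, y⟩, hx ⟨m, y⟩⟩
  · have hle : (E.map fun e => dist (φ e.1) (φ e.2)).sum ≤ 2 * G.length := by
      calc (E.map fun e => dist (φ e.1) (φ e.2)).sum
          ≤ (E.map fun e => 2 * dist e.1 e.2).sum := by
            refine List.sum_le_sum fun e he => dist_pullback_le (by positivity) fun s t => ?_
            exact hR e.1 e.2 _ _ _ _ (hxE s e he) (hxE t e he)
        _ = 2 * (E.map fun e => dist e.1 e.2).sum := List.sum_map_mul_left _ _ _
        _ ≤ 2 * G.length := by linarith [hE.sum_dist_le hadj]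
    refine ((hE.spans φ).mono ?_).move (by simpa using hle)
    rintro _ ⟨m, rfl⟩
    exact ⟨_, Set.mem_univ _, rfl⟩

theorem exists_shortest_graph {M : Finset GHSpace} (hM : M.Nonempty)
    (hfin : ∀ m ∈ M, Finite m.Rep) :
    ∃ G : GraphOn GHSpace, G.Connects M ∧ ∀ G' : GraphOn GHSpace, G'.Connects M →
      G.length ≤ G'.length := by
  obtain ⟨m₀, hm₀⟩ := hM
  have hfin' (m : M) : Finite m.1.Rep := hfin m.1 m.2
  have : Fintype (Threads M) := Fintype.ofFinite _
  have : Nonempty M := ⟨⟨m₀, hm₀⟩⟩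
  have : Nonempty (Threads M) := ⟨⟨⟨m₀, hm₀⟩, Classical.arbitrary _⟩⟩
  choose l hl using fun φ : M → pseudometrics (Threads M) =>
    Spans.exists_isLeast (Set.finite_range φ) (Set.range_nonempty φ) (φ ⟨m₀, hm₀⟩)
  have hne : (terminalLifts M).Nonempty := by
    classical
    have (m : M) : ∃ f : Threads M → m.1.Rep, f.Surjective := by
      refine ⟨fun t => if h : t.1 = m then h ▸ t.2 else Classical.arbitrary _,
        fun y => ⟨⟨m, y⟩, by simp⟩⟩
    choose f hf using this
    exact ⟨fun m => pullback (f m), fun m => ⟨f m, hf m, rfl⟩⟩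
  -- The shortest length `l φ` is minimized over the finitely many possible lifts of the terminals.
  obtain ⟨φ, hφ, hmin⟩ := Set.exists_min_image _ l finite_terminalLifts hne
  have himage : (M : Set GHSpace) ⊆ toGH '' Set.range φ := by
    intro m hm
    obtain ⟨f, hf, hφf⟩ := hφ ⟨m, hm⟩
    exact ⟨_, ⟨⟨m, hm⟩, rfl⟩, by rw [hφf, toGH_pullback hf]⟩
  obtain ⟨G, hG, hlen⟩ :=
    (((hl φ).1.map (by norm_num : (0 : ℝ) ≤ 1 / 2) dist_toGH_le).mono himage).exists_connects
  refine ⟨G, hG, fun G' hG' => ?_⟩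
  obtain ⟨ψ, hψ, hspan⟩ := exists_lift ⟨m₀, hm₀⟩ hG'
  linarith [hmin ψ hψ, (hl ψ).2 hspan]

end SteinerGH

theorem mainTheorem1 (n : ℕ) (M : Finset GromovHausdorff.GHSpace)
    (hM : ∀ m ∈ M, m ∈ SteinerGH.atMost n) :
    (SteinerGH.SMT M).Nonempty ∧ ∀ G ∈ SteinerGH.SMT M, G.graph.IsTree := by
  refine ⟨?_, fun G hG => SteinerGH.isTree_of_mem_SMT hG⟩
  obtain ⟨G, hG, hmin⟩ : ∃ G : SteinerGH.GraphOn GromovHausdorff.GHSpace, G.Connects M ∧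
      ∀ G' : SteinerGH.GraphOn GromovHausdorff.GHSpace, G'.Connects M → G.length ≤ G'.length := by
    rcases M.eq_empty_or_nonempty with rfl | hne
    · obtain ⟨G, hG, hlen⟩ := ((SteinerGH.Spans.single
        (default : GromovHausdorff.GHSpace)).mono
          (B := ((∅ : Finset GromovHausdorff.GHSpace) : Set GromovHausdorff.GHSpace))
          (by simp)).exists_connects
      exact ⟨G, hG, fun G' _ => hlen.trans G'.length_nonneg⟩
    · exact SteinerGH.exists_shortest_graph hne
        fun m hm => SteinerGH.finite_rep_of_mem_atMost (hM m hm)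
  exact ⟨G, hG, le_antisymm
    (le_csInf ⟨_, G, hG, rfl⟩ (by rintro _ ⟨G', hG', rfl⟩; exact hmin G' hG'))
    (SteinerGH.smt_le hG)⟩
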